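/- For a ring $R$ with identity, let $\mathrm{l.Fin.dim}(R)\in\{0,1,2,\dots\}\cup\{\infty\}$ denote the supremum of the projective dimensions of those left $R$-modules that have finite projective dimension (the modules need not be finitely generated, and the zero module is counted with projective dimension $0$). Let $n\ge 1$ and let $A$ be a ring with identity. For $2\le i\le n$ let $A_i$ be a subring of $A$ with the same identity as $A$ and let $I_i$ be a two-sided ideal of $A$, and for $2\le j<i\le n$ let $I_{ij}$ be a two-sided ideal of $A$, such that $I_n\subseteq I_{n-1}\subseteq\cdots\subseteq I_2$, $I_i\subseteq A_i$ for $2\le i\le n$, and $I_j\subseteq I_{ij}$ and $\sum_{l=j+1}^{i-1}I_{il}I_{lj}\subseteq I_{ij}$ for $2\le j<i\le n$. Let $\Lambda$ be the subring of the $n\times n$ matrix ring $M_n(A)$ consisting of the matrices $(a_{ij})_{1\le i,j\le n}$ whose entries in the first column are arbitrary elements of $A$ and which for $j\ge 2$ satisfy $a_{ij}\in I_j$ if $i<j$, $a_{jj}\in A_j$, and $a_{ij}\in I_{ij}$ if $i>j$; that is, $$\Lambda=\begin{pmatrix} A & I_2 & I_3 & \cdots & I_{n-1} & I_n\\ A &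 A_2 & I_3 & \cdots & I_{n-1} & I_n\\ A & I_{32} & A_3 & \cdots & I_{n-1} & I_n\\ A & I_{42} & I_{43} & \ddots & \vdots & \vdots\\ \vdots & \vdots & \vdots & \ddots & A_{n-1} & I_n\\ A & I_{n2} & I_{n3} & \cdots & I_{n,n-1} & A_n \end{pmatrix}.$$ Then $$\mathrm{l.Fin.dim}(A)-1\;\le\;\mathrm{l.Fin.dim}(\Lambda)\;\le\; n+\sum_{i=2}^n \mathrm{l.Fin.dim}(A_i/I_i)+\mathrm{l.Fin.dim}(A),$$ where both inequalities are understood in $\mathbb{Z}\cup\{\infty\}$. -/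

import Mathlib

open CategoryTheory

universe u

/-- The left finitistic dimension of a ring `R`: the supremum of the projective dimensions of all
left `R`-modules of finite projective dimension. The zero module, for which `projectiveDimension`
takes the value `⊥`, is counted with projective dimension `0`, so that the value is in `ℕ∞` (and is
`0` for the zero ring). -/
noncomputable def leftFinDim (R : Type u) [Ring R] : ℕ∞ :=
  ⨆ (M : ModuleCat.{u} R) (_ : projectiveDimension M ≠ ⊤), (projectiveDimension M).unbotD 0

/-- The data from which the matrix ring `Λ` is built: subrings `B i` of `A` (for `2 ≤ i ≤ n`),
two-sided ideals `I i` of `A` (for `2 ≤ i ≤ n`), and two-sided ideals `J i j` of `A` (for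
`2 ≤ j < i ≤ n`), subject to the stated inclusions. The values at other indices play no role. -/
structure MatrixRingData (A : Type u) [Ring A] (n : ℕ) where
  /-- The subrings on the diagonal (a `Subring` has the same identity as `A`). -/
  B : ℕ → Subring A
  /-- The ideals above the diagonal. -/
  I : ℕ → Ideal A
  /-- The ideals below the diagonal. -/
  J : ℕ → ℕ → Ideal A
  isTwoSided_I : ∀ i, (I i).IsTwoSided
  isTwoSided_J : ∀ i j, (J i j).IsTwoSided
  I_anti : ∀ i j, 2 ≤ i → i ≤ j → j ≤ n → I j ≤ I i
  I_sub_B : ∀ i, 2 ≤ i → i ≤ n → ∀ a ∈ I i, a ∈ B i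
  I_le_J : ∀ i j, 2 ≤ j → j < i → i ≤ n → I j ≤ J i j
  sum_le_J : ∀ i j, 2 ≤ j → j < i → i ≤ n → ∑ l ∈ Finset.Ioo j i, J i l * J l j ≤ J i j

namespace MatrixRingData

variable {A : Type u} [Ring A] {n : ℕ} (D : MatrixRingData A n)

instance (i : ℕ) : (D.I i).IsTwoSided := D.isTwoSided_I i

instance (i j : ℕ) : (D.J i j).IsTwoSided := D.isTwoSided_J i j

/-- The set of allowed entries in row `i` and column `j` (`1 ≤ i, j ≤ n`): `A` in the first column,
and in a column `j ≥ 2`, `I j` above the diagonal, `B j` on it, and `J i j` below it. -/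
def entry (i j : ℕ) : AddSubgroup A :=
  if j = 1 then ⊤
  else if i < j then (D.I j).toAddSubgroup
  else if i = j then (D.B i).toAddSubgroup
  else (D.J i j).toAddSubgroup

lemma one_mem_entry (i : ℕ) : (1 : A) ∈ D.entry i i := by
  unfold entry
  split_ifs <;> first | trivial | exact (D.B i).one_mem | omega

lemma mul_mem_entry {i l j : ℕ} (hi : 1 ≤ i) (hin : i ≤ n) (hl : 1 ≤ l) (hln : l ≤ n)
    (hj : 1 ≤ j) (hjn : j ≤ n) {a b : A} (ha : a ∈ D.entry i l) (hb : b ∈ D.entry l j) :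
    a * b ∈ D.entry i j := by
  by_cases hj1 : j = 1
  · simp [entry, hj1]
  -- a factor in `I j` puts the product into every entry of column `j`
  have key : a * b ∈ D.I j → a * b ∈ D.entry i j := by
    intro h
    unfold entry
    rw [if_neg hj1]
    split_ifs with h2 h3
    · exact h
    · subst h3; exact D.I_sub_B i (by omega) hin _ h
    · exact D.I_le_J i j (by omega) (by omega) hin h
  rcases lt_trichotomy l j with hlj | hlj | hlj
  · -- `b ∈ I j`
    have hb' : b ∈ D.I j := by simpa [entry, hj1, hlj] using hb
    exact key ((D.I j).mul_mem_left a hb')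
  · subst hlj
    have hb' : b ∈ D.B l := by simpa [entry, hj1] using hb
    rcases lt_trichotomy i l with h | h | h
    · have ha' : a ∈ D.I l := by simpa [entry, hj1, h] using ha
      exact key ((D.I l).mul_mem_right b ha')
    · subst h
      have ha' : a ∈ D.B i := by simpa [entry, hj1] using ha
      simpa [entry, hj1] using (D.B i).mul_mem ha' hb'
    · have ha' : a ∈ D.J i l := by simpa [entry, hj1, h.not_gt, h.ne'] using ha
      simpa [entry, hj1, h.not_gt, h.ne'] using (D.J i l).mul_mem_right b ha'
  · have hl1 : l ≠ 1 := by omega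
    have hb' : b ∈ D.J l j := by simpa [entry, hj1, hlj.not_gt, hlj.ne'] using hb
    rcases lt_trichotomy i l with h | h | h
    · have ha' : a ∈ D.I l := by simpa [entry, hl1, h] using ha
      exact key (D.I_anti j l (by omega) hlj.le hln ((D.I l).mul_mem_right b ha'))
    · subst h
      simpa [entry, hj1, hlj.not_gt, hlj.ne'] using (D.J i j).mul_mem_left a hb'
    · have ha' : a ∈ D.J i l := by simpa [entry, hl1, h.not_gt, h.ne'] using ha
      have hij : j < i := by omega
      have hab : a * b ∈ D.J i l * D.J l j := Ideal.mul_mem_mul ha' hb'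
      have hle : D.J i l * D.J l j ≤ ∑ l ∈ Finset.Ioo j i, D.J i l * D.J l j :=
        Finset.single_le_sum (f := fun l => D.J i l * D.J l j)
          (fun _ _ => bot_le) (Finset.mem_Ioo.2 ⟨hlj, h⟩)
      have := D.sum_le_J i j (by omega) hij hin (hle hab)
      simpa [entry, hj1, hij.not_gt, hij.ne'] using this

/-- The ring `Λ` of all `n × n` matrices over `A` whose entries lie in the prescribed sets; the
index `i : Fin n` stands for the row or column number `i + 1`. -/
def matrixRing : Subring (Matrix (Fin n) (Fin n) A) where
  carrier := {M | ∀ i j : Fin n, M i j ∈ D.entry (i + 1) (j + 1)}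
  zero_mem' := fun _ _ => zero_mem _
  one_mem' := fun i j => by
    by_cases h : i = j
    · subst h; simpa using D.one_mem_entry _
    · simp [Matrix.one_apply_ne h]
  add_mem' := fun hM hN i j => add_mem (hM i j) (hN i j)
  neg_mem' := fun hM i j => neg_mem (hM i j)
  mul_mem' := fun {M N} hM hN i j => by
    rw [Matrix.mul_apply]
    exact sum_mem fun l _ => D.mul_mem_entry (by omega) (by omega) (by omega) (by omega)
      (by omega) (by omega) (hM i l) (hN l j)

/-- The quotient ring `A_i / I_i`, where `I_i ⊆ A_i` is regarded as an ideal of `A_i`. -/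
abbrev diagQuotient (i : ℕ) : Type u :=
  D.B i ⧸ (D.I i).comap (D.B i).subtype

end MatrixRingData

/-! Let e be an idempotent of a ring Λ such that Λe is free of finite rank over the corner ring C =
eΛe, and let Γ = Λ/ΛeΛ. The functor X ↦ Λe ⊗ X is exact and preserves and reflects projectives,
hence also projective dimension (`projDimLE_ind_iff`). This bounds l.Fin.dim(C) by l.Fin.dim(Λ).

For the upper bound, suppose that Λe ⊗ eM → M is injective for M and for Λ itself. Then M ↦ M/ΛeM
carries a free resolution of M to a projective one over Γ (`projDimLE_red`), so after l.Fin.dim(Γ)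
syzygies the reduction is projective. At that point a swindle compares M ⊕ L, with L projective, to
L modulo the traces; the comparison has a kernel induced from C, so at most l.Fin.dim(C) + 1 further
steps are needed (`projDimLE_of_projective_red`). Submodules of free modules inherit injectivity
from Λ, so one more syzygy handles arbitrary M and gives l.Fin.dim(Γ) + l.Fin.dim(C) + 2.

For the matrix ring, the first diagonal idempotent has corner A, and Γ is lower triangular with
diagonal A_i/I_i for 2 ≤ i ≤ n. In a lower triangular ring the last diagonal idempotent satisfies Λe
= eΛe, so injectivity holds for every module and splitting it off costs only 1. The last remaining
entry costs nothing, and the constants add up to 2 + (n - 2) = n. -/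

/-! ### Bounded projective dimension -/

/-- `M` has projective dimension at most `d`. -/
def ProjDimLE (R : Type u) [Ring R] (d : ℕ) (M : Type u) [AddCommGroup M] [Module R M] : Prop :=
  HasProjectiveDimensionLE (ModuleCat.of R M) d

namespace ProjDimLE

variable {R : Type u} [Ring R] {M N : Type u} [AddCommGroup M] [Module R M]
  [AddCommGroup N] [Module R N] {d : ℕ}

lemma zero_iff : ProjDimLE R 0 M ↔ Module.Projective R M := by
  rw [IsProjective.iff_projective, projective_iff_hasProjectiveDimensionLE_zero]
  rfl

lemma mono {d' : ℕ} (h : ProjDimLE R d M) (hd : d ≤ d') : ProjDimLE R d' M :=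
  have : HasProjectiveDimensionLT (ModuleCat.of R M) (d + 1) := h
  hasProjectiveDimensionLT_of_ge (ModuleCat.of R M) (d + 1) (d' + 1) (by omega)

lemma of_equiv (e : M ≃ₗ[R] N) (h : ProjDimLE R d M) : ProjDimLE R d N :=
  have : HasProjectiveDimensionLT (ModuleCat.of R M) (d + 1) := h
  hasProjectiveDimensionLT_of_iso e.toModuleIso (d + 1)

lemma succ_iff_ker [Module.Projective R M] {f : M →ₗ[R] N} (hf : Function.Surjective f) :
    ProjDimLE R (d + 1) N ↔ ProjDimLE R d (LinearMap.ker f) :=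
  (LinearMap.shortExact_shortComplexKer hf).hasProjectiveDimensionLT_X₃_iff d
    ((IsProjective.iff_projective M).1 inferInstance)

lemma of_retract (i : M →ₗ[R] N) (r : N →ₗ[R] M) (h : r ∘ₗ i = LinearMap.id)
    (hN : ProjDimLE R d N) : ProjDimLE R d M :=
  have : HasProjectiveDimensionLT (ModuleCat.of R N) (d + 1) := hN
  Retract.hasProjectiveDimensionLT (Y := ModuleCat.of R N)
    ⟨ModuleCat.ofHom i, ModuleCat.ofHom r, by rw [← ModuleCat.ofHom_comp, h]; rfl⟩ (d + 1)

/-- The kernel of the product of a linear map with an identity map. -/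
noncomputable def _root_.LinearMap.kerProdMapId
    {P : Type*} [AddCommGroup P] [Module R P] (f : P →ₗ[R] M) :
    LinearMap.ker f ≃ₗ[R] LinearMap.ker (f.prodMap (LinearMap.id : N →ₗ[R] N)) :=
  LinearEquiv.ofBijective
    ((LinearMap.inl R P N ∘ₗ (LinearMap.ker f).subtype).codRestrict _ fun p => by simp)
    ⟨fun p q h => Subtype.ext (congrArg (fun z => (z.1 : P × N).1) h),
     fun ⟨⟨p, q⟩, hp⟩ => by
      have hp' : f p = 0 ∧ q = 0 := by simpa using hp
      exact ⟨⟨p, hp'.1⟩, Subtype.ext (Prod.ext rfl hp'.2.symm)⟩⟩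

/-- Adding `N` to both ends of a free cover of `M` leaves the kernel unchanged. -/
lemma prod_projective [Module.Projective R N] (h : ProjDimLE R d M) : ProjDimLE R d (M × N) := by
  cases d with
  | zero =>
    rw [zero_iff] at h ⊢
    infer_instance
  | succ d =>
    have hs : Function.Surjective (Finsupp.linearCombination R (id : M → M)) :=
      Finsupp.linearCombination_id_surjective R M
    rw [succ_iff_ker hs] at h
    exact (succ_iff_ker (f := (Finsupp.linearCombination R (id : M → M)).prodMap
      (LinearMap.id : N →ₗ[R] N)) (hs.prodMap Function.surjective_id)).2
      (h.of_equiv (LinearMap.kerProdMapId _))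

end ProjDimLE

lemma leftFinDim_le_iff {R : Type u} [Ring R] {d : ℕ} :
    leftFinDim R ≤ d ↔ ∀ (M : Type u) [AddCommGroup M] [Module R M] (k : ℕ),
      ProjDimLE R k M → ProjDimLE R d M := by
  have key (M : ModuleCat.{u} R) : (projectiveDimension M).unbotD 0 ≤ (d : ℕ∞) ↔
      HasProjectiveDimensionLE M d := by
    rw [← projectiveDimension_le_iff]
    generalize projectiveDimension M = a
    induction a with
    | bot => simp
    | coe a => simp only [WithBot.unbotD_coe]; exact (WithBot.coe_le_coe (a := a) (b := d)).symm
  simp only [leftFinDim, iSup_le_iff, key, projectiveDimension_ne_top_iff]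
  exact ⟨fun h M _ _ k hk => h (ModuleCat.of R M) ⟨k, hk⟩, fun h M ⟨k, hk⟩ => h M k hk⟩

lemma ProjDimLE.of_leftFinDim_le {R : Type u} [Ring R] {d k : ℕ} (h : leftFinDim R ≤ d)
    {M : Type u} [AddCommGroup M] [Module R M] (hM : ProjDimLE R k M) : ProjDimLE R d M :=
  leftFinDim_le_iff.1 h M k hM

/-! ### Idempotents with free left ideal over the corner ring -/

/-- Rings `Λ`, `Γ`, `A` with an idempotent `φ 1` of `Λ` whose corner ring is `A`, such that
`Λ (φ 1)` is free over the corner with the finite basis `x`, and such that `Γ` is the quotient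
of `Λ` by the ideal generated by `φ 1`. The ring homomorphism `ρ` gives the action of `Λ` on
`Λ (φ 1)` in the basis `x`. -/
structure CornerData (ι : Type) [Fintype ι] [DecidableEq ι] (Λ Γ A : Type u)
    [Ring Λ] [Ring Γ] [Ring A] where
  /-- The quotient map. -/
  π : Λ →+* Γ
  /-- The action on `Λ (φ 1)` in coordinates. -/
  ρ : Λ →+* Matrix ι ι A
  /-- The inclusion of the corner ring. -/
  φ : A →+ Λ
  /-- The index of the basis element that is the idempotent. -/
  i₀ : ι
  /-- The basis of `Λ (φ 1)`. -/
  x : ι → Λ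
  π_surjective : Function.Surjective π
  φ_mul : ∀ a b, φ (a * b) = φ a * φ b
  x_i₀ : x i₀ = φ 1
  x_mul : ∀ i, x i * φ 1 = x i
  ρ_φ : ∀ a, ρ (φ a) = Matrix.single i₀ i₀ a
  ρ_x : ∀ i, ρ (x i) = Matrix.single i i₀ 1
  mul_x : ∀ l i, l * x i = ∑ j, x j * φ (ρ l j i)
  π_φ_one : π (φ 1) = 0
  exists_of_π_eq_zero : ∀ l, π l = 0 → ∃ y : ι → Λ, ∑ i, x i * y i = l

namespace CornerData

variable {ι : Type} [Fintype ι] [DecidableEq ι] {Λ Γ A : Type u} [Ring Λ] [Ring Γ] [Ring A]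
  (D : CornerData ι Λ Γ A)

lemma φ_one_mul_φ (a : A) : D.φ 1 * D.φ a = D.φ a := by rw [← D.φ_mul, one_mul]

section Fixed

variable (M : Type u) [AddCommGroup M] [Module Λ M]

/-- The additive group `e M`, where `e = φ 1`. -/
def fixed : AddSubgroup M where
  carrier := {m | D.φ 1 • m = m}
  zero_mem' := smul_zero _
  add_mem' {a b} ha hb := by
    simp only [Set.mem_ofPred_eq] at *
    rw [smul_add, ha, hb]
  neg_mem' {a} ha := by
    simp only [Set.mem_ofPred_eq] at *
    rw [smul_neg, ha]

variable {M}

lemma mem_fixed {m : M} : m ∈ D.fixed M ↔ D.φ 1 • m = m := Iff.rfl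

lemma φ_smul_mem_fixed (a : A) (m : M) : D.φ a • m ∈ D.fixed M := by
  rw [mem_fixed, ← mul_smul, D.φ_one_mul_φ]

/-- `e M` is a module over the corner ring. -/
instance : Module A (D.fixed M) where
  smul a m := ⟨D.φ a • (m : M), D.φ_smul_mem_fixed a (m : M)⟩
  one_smul m := Subtype.ext m.2
  mul_smul a b m := Subtype.ext (by
    change D.φ (a * b) • (m : M) = D.φ a • D.φ b • (m : M)
    rw [D.φ_mul, mul_smul])
  smul_zero a := Subtype.ext (smul_zero (D.φ a : Λ) : D.φ a • (0 : M) = 0)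
  smul_add a m m' := Subtype.ext (smul_add (D.φ a) (m : M) (m' : M))
  add_smul a b m := Subtype.ext (by
    change D.φ (a + b) • (m : M) = D.φ a • (m : M) + D.φ b • (m : M)
    rw [map_add, add_smul])
  zero_smul m := Subtype.ext (by
    change D.φ 0 • (m : M) = 0
    rw [map_zero, zero_smul])

@[simp]
lemma coe_fixed_smul (a : A) (m : D.fixed M) : ((a • m : D.fixed M) : M) = D.φ a • (m : M) := rfl

variable {N : Type u} [AddCommGroup N] [Module Λ N]

lemma map_mem_fixed (f : M →ₗ[Λ] N) {m : M} (hm : m ∈ D.fixed M) : f m ∈ D.fixed N := by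
  rw [mem_fixed] at *
  rw [← map_smul, hm]

/-- The map induced on `e M`. -/
def fixedMap (f : M →ₗ[Λ] N) : D.fixed M →ₗ[A] D.fixed N where
  toFun m := ⟨f m, D.map_mem_fixed f m.2⟩
  map_add' _ _ := Subtype.ext (map_add f _ _)
  map_smul' _ _ := Subtype.ext (map_smul f _ _)

lemma fixedMap_surjective {f : M →ₗ[Λ] N} (hf : Function.Surjective f) :
    Function.Surjective (D.fixedMap f) := by
  rintro ⟨n, hn⟩
  obtain ⟨m, rfl⟩ := hf n
  exact ⟨⟨D.φ 1 • m, D.φ_smul_mem_fixed 1 m⟩, Subtype.ext ((map_smul f _ _).trans hn)⟩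

end Fixed

/-! ### Induction from the corner ring -/

section Ind

variable (X : Type u) [AddCommGroup X] [Module A X]

/-- The `Λ`-module `Λ e ⊗ X` for a module `X` over the corner ring. -/
def ind (_D : CornerData ι Λ Γ A) (X : Type u) : Type u := ι → X

instance : AddCommGroup (D.ind X) := inferInstanceAs (AddCommGroup (ι → X))

open scoped Matrix.Module in
instance : Module Λ (D.ind X) := Module.compHom (ι → X) D.ρ

variable {X}

lemma ind_smul_apply (l : Λ) (v : D.ind X) (i : ι) : (l • v) i = ∑ j, D.ρ l i j • v j := rfl

lemma φ_smul_ind_apply (a : A) (v : D.ind X) : (D.φ a • v) D.i₀ = a • v D.i₀ := by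
  rw [ind_smul_apply, D.ρ_φ, Finset.sum_eq_single D.i₀]
  · simp
  · intro j _ hj; simp [Ne.symm hj]
  · simp

/-- The element of `Λ e ⊗ X` given by the idempotent and an element of `X`. -/
def incl (y : X) : D.ind X := Pi.single D.i₀ y

lemma incl_add {X : Type u} [AddCommGroup X] (y z : X) :
    D.incl (y + z) = D.incl y + D.incl z := Pi.single_add _ _ _

lemma incl_smul (a : A) (y : X) : D.incl (a • y) = D.φ a • D.incl y := by
  funext i
  rw [ind_smul_apply, D.ρ_φ, Finset.sum_eq_single D.i₀]
  · by_cases h : i = D.i₀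
    · subst h; simp [incl]
    · simp [incl, h, Ne.symm h]
  · intro j _ hj; simp [incl, hj]
  · simp

lemma incl_mem_fixed (y : X) : D.incl y ∈ D.fixed (D.ind X) := by
  rw [mem_fixed, ← incl_smul, one_smul]

lemma x_smul_incl (i : ι) (y : X) : D.x i • D.incl y = (Pi.single i y : ι → X) := by
  funext j
  rw [ind_smul_apply, D.ρ_x, Finset.sum_eq_single D.i₀]
  · by_cases h : j = i
    · subst h; simp [incl]
    · simp [h, Ne.symm h]
  · intro k _ hk; simp [incl, hk]
  · simp

lemma sum_x_smul_incl (v : D.ind X) : ∑ i, D.x i • D.incl (v i) = v := by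
  simp_rw [x_smul_incl]
  exact Finset.univ_sum_single v

variable {Y : Type u} [AddCommGroup Y] [Module A Y]

/-- Functoriality of `Λ e ⊗ X`. -/
def indMap (f : X →ₗ[A] Y) : D.ind X →ₗ[Λ] D.ind Y where
  toFun v i := f (v i)
  map_add' v w := funext fun i => map_add f _ _
  map_smul' l v := funext fun i => by
    simp only [ind_smul_apply, map_sum, map_smul]
    rfl

lemma indMap_surjective {f : X →ₗ[A] Y} (hf : Function.Surjective f) :
    Function.Surjective (D.indMap f) := fun w =>
  ⟨fun i => (hf (w i)).choose, funext fun i => (hf (w i)).choose_spec⟩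

/-- `Λ e ⊗ X` is exact in `X`. -/
def indKer (f : X →ₗ[A] Y) :
    D.ind (LinearMap.ker f) ≃ₗ[Λ] LinearMap.ker (D.indMap f) where
  toFun v := ⟨D.indMap (LinearMap.ker f).subtype v, funext fun i => (v i).2⟩
  invFun w := fun i => ⟨w.1 i, congrFun w.2 i⟩
  left_inv _ := rfl
  right_inv _ := rfl
  map_add' _ _ := rfl
  map_smul' l v := Subtype.ext (map_smul (D.indMap (LinearMap.ker f).subtype) l v)

variable {M : Type u} [AddCommGroup M] [Module Λ M]

/-- The map `Λ e ⊗ X → M` that extends a map `X → e M`. -/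
def extend (s : X →ₗ[A] D.fixed M) : D.ind X →ₗ[Λ] M where
  toFun v := ∑ i, D.x i • (s (v i) : M)
  map_add' v w := by
    rw [← Finset.sum_add_distrib]
    refine Finset.sum_congr rfl fun i _ => ?_
    rw [← smul_add]
    exact congrArg _ (congrArg Subtype.val (map_add s (v i) (w i)))
  map_smul' l v := by
    simp only [ind_smul_apply, map_sum, AddSubgroup.val_finsetSum, map_smul, coe_fixed_smul,
      Finset.smul_sum, RingHom.id_apply, ← mul_smul, D.mul_x, Finset.sum_smul]
    exact Finset.sum_comm

lemma extend_apply (s : X →ₗ[A] D.fixed M) (v : D.ind X) :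
    D.extend s v = ∑ i, D.x i • (s (v i) : M) := rfl

/-- Λ-maps out of Λe ⊗ X correspond to `A`-maps from `X` to eM, and M ↦ eM preserves surjections. -/
lemma projective_ind [Module.Projective A X] : Module.Projective Λ (D.ind X) := by
  refine Module.Projective.of_lifting_property'' fun f hf => ?_
  obtain ⟨s, hs⟩ := Module.projective_lifting_property (D.fixedMap f)
    ({ toFun := fun y => ⟨D.incl y, D.incl_mem_fixed y⟩
       map_add' := fun y z => Subtype.ext (D.incl_add y z)
       map_smul' := fun a y => Subtype.ext (D.incl_smul a y) } : X →ₗ[A] D.fixed (D.ind X))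
    (D.fixedMap_surjective hf)
  refine ⟨D.extend s, LinearMap.ext fun v => ?_⟩
  have hs' (y : X) : f (s y : D.ind X →₀ Λ) = D.incl y :=
    congrArg Subtype.val (LinearMap.congr_fun hs y)
  simp only [LinearMap.comp_apply, extend_apply, map_sum, map_smul, hs', LinearMap.id_apply]
  exact D.sum_x_smul_incl v

/-- A Λ-linear section of the induced map restricts to a section of `f`: apply it to `incl y` and
read off the coordinate `i₀`. -/
lemma projective_of_ind [Module.Projective Λ (D.ind X)] : Module.Projective A X := by
  refine Module.Projective.of_lifting_property'' fun f hf => ?_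
  obtain ⟨s, hs⟩ := Module.projective_lifting_property (D.indMap f)
    (LinearMap.id : D.ind X →ₗ[Λ] D.ind X) (D.indMap_surjective hf)
  refine ⟨{ toFun := fun y => s (D.incl y) D.i₀
            map_add' := fun y z => ?_
            map_smul' := fun a y => ?_ }, LinearMap.ext fun y => ?_⟩
  · rw [incl_add, map_add]; rfl
  · rw [incl_smul, map_smul, φ_smul_ind_apply]; rfl
  · exact (congrFun (LinearMap.congr_fun hs (D.incl y)) D.i₀).trans (Pi.single_eq_same _ _)

/-- Induction is exact, being a finite power on underlying groups, so syzygies correspond and the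
claim reduces to projectivity. -/
lemma projDimLE_ind_iff {d : ℕ} : ProjDimLE Λ d (D.ind X) ↔ ProjDimLE A d X := by
  induction d generalizing X with
  | zero =>
    rw [ProjDimLE.zero_iff, ProjDimLE.zero_iff]
    exact ⟨fun _ => D.projective_of_ind, fun _ => D.projective_ind⟩
  | succ d ih =>
    have hs := Finsupp.linearCombination_id_surjective A X
    have := D.projective_ind (X := X →₀ A)
    rw [ProjDimLE.succ_iff_ker hs, ProjDimLE.succ_iff_ker (D.indMap_surjective hs), ← ih]
    exact ⟨.of_equiv (D.indKer _).symm, .of_equiv (D.indKer _)⟩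

end Ind

theorem leftFinDim_corner_le (D : CornerData ι Λ Γ A) : leftFinDim A ≤ leftFinDim Λ := by
  rcases eq_or_ne (leftFinDim Λ) ⊤ with h | h
  · simp [h]
  · obtain ⟨d, hd⟩ := ENat.ne_top_iff_exists.1 h
    rw [← hd, leftFinDim_le_iff]
    exact fun X _ _ k hk =>
      D.projDimLE_ind_iff.1 ((D.projDimLE_ind_iff.2 hk).of_leftFinDim_le hd.ge)

end CornerData

/-! ### The trace ΛeM and reduction modulo it -/

namespace CornerData

variable {ι : Type} [Fintype ι] [DecidableEq ι] {Λ Γ A : Type u} [Ring Λ] [Ring Γ] [Ring A]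
  (D : CornerData ι Λ Γ A)

section Trace

variable (M : Type u) [AddCommGroup M] [Module Λ M]

/-- The submodule `Λ e M`, where `e = φ 1`. -/
def trace : Submodule Λ M where
  carrier := {m | ∃ k : ι → M, ∑ i, D.x i • k i = m}
  zero_mem' := ⟨0, by simp⟩
  add_mem' := by
    rintro _ _ ⟨k, rfl⟩ ⟨k', rfl⟩
    exact ⟨k + k', by simp [Finset.sum_add_distrib]⟩
  smul_mem' := by
    rintro l _ ⟨k, rfl⟩
    refine ⟨fun j => ∑ i, D.φ (D.ρ l j i) • k i, ?_⟩
    simp only [Finset.smul_sum, ← mul_smul, D.mul_x, Finset.sum_smul]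
    exact Finset.sum_comm

variable {M}

lemma exists_fixed_of_mem_trace {m : M} (hm : m ∈ D.trace M) :
    ∃ k : ι → M, (∀ i, k i ∈ D.fixed M) ∧ ∑ i, D.x i • k i = m := by
  obtain ⟨k, rfl⟩ := hm
  exact ⟨fun i => D.φ 1 • k i, fun i => D.φ_smul_mem_fixed 1 (k i), by
    simp only [← mul_smul, D.x_mul]⟩

variable {N : Type u} [AddCommGroup N] [Module Λ N]

lemma map_mem_trace (f : M →ₗ[Λ] N) {m : M} (hm : m ∈ D.trace M) : f m ∈ D.trace N := by
  obtain ⟨k, rfl⟩ := hm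
  exact ⟨fun i => f (k i), by simp⟩

lemma exists_mem_trace_of_surjective {f : M →ₗ[Λ] N} (hf : Function.Surjective f) {n : N}
    (hn : n ∈ D.trace N) : ∃ m ∈ D.trace M, f m = n := by
  obtain ⟨k, rfl⟩ := hn
  choose g hg using hf
  exact ⟨_, ⟨fun i => g (k i), rfl⟩, by simp [hg]⟩

lemma mem_trace_prod {m : M} {n : N} (hm : m ∈ D.trace M) (hn : n ∈ D.trace N) :
    (m, n) ∈ D.trace (M × N) := by
  simpa using add_mem (D.map_mem_trace (LinearMap.inl Λ M N) hm)
    (D.map_mem_trace (LinearMap.inr Λ M N) hn)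

lemma mem_trace_finsupp {S : Type} {f : S →₀ M} (hf : ∀ s, f s ∈ D.trace M) :
    f ∈ D.trace (S →₀ M) := by
  rw [← f.sum_single]
  exact sum_mem fun s _ => D.map_mem_trace (Finsupp.lsingle s) (hf s)

lemma mem_trace_ind {X : Type u} [AddCommGroup X] [Module A X] (v : D.ind X) :
    v ∈ D.trace (D.ind X) := ⟨_, D.sum_x_smul_incl v⟩

end Trace

section Injective

/-- The multiplication map `Λ e ⊗ e M → M` is injective. -/
def TraceInjective (M : Type u) [AddCommGroup M] [Module Λ M] : Prop :=
  ∀ k : ι → M, (∀ i, k i ∈ D.fixed M) → ∑ i, D.x i • k i = 0 → ∀ i, k i = 0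

namespace TraceInjective

variable {D} {M N : Type u} [AddCommGroup M] [Module Λ M] [AddCommGroup N] [Module Λ N]

lemma of_injective (hM : D.TraceInjective M) (f : N →ₗ[Λ] M) (hf : Function.Injective f) :
    D.TraceInjective N := fun k hk h i =>
  (map_eq_zero_iff f hf).1 (hM (fun i => f (k i)) (fun i => D.map_mem_fixed f (hk i))
    (by simpa using congrArg f h) i)

lemma prod (hM : D.TraceInjective M) (hN : D.TraceInjective N) : D.TraceInjective (M × N) :=
  fun k hk h i => Prod.ext
    (hM (fun i => (k i).1) (fun i => D.map_mem_fixed (LinearMap.fst Λ M N) (hk i))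
      (by simpa using congrArg (LinearMap.fst Λ M N) h) i)
    (hN (fun i => (k i).2) (fun i => D.map_mem_fixed (LinearMap.snd Λ M N) (hk i))
      (by simpa using congrArg (LinearMap.snd Λ M N) h) i)

lemma finsupp {S : Type u} (hM : D.TraceInjective M) : D.TraceInjective (S →₀ M) :=
  fun k hk h i => Finsupp.ext fun s =>
    hM (fun i => k i s) (fun i => D.map_mem_fixed (Finsupp.lapply s) (hk i))
      (by simpa using congrArg (Finsupp.lapply (R := Λ) s) h) i

lemma of_projective (hΛ : D.TraceInjective Λ) [Module.Projective Λ M] : D.TraceInjective M := by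
  obtain ⟨s, hs⟩ := Module.Projective.out (R := Λ) (P := M)
  exact (hΛ.finsupp (S := M)).of_injective s hs.injective

/-- The coefficients in eN of an element of the kernel map to a relation in `M`; injectivity kills
each image, so the coefficients already lie in the kernel. This is what makes reduction exact in
`redKer`. -/
lemma mem_trace_ker (hM : D.TraceInjective M) (f : N →ₗ[Λ] M) (n : LinearMap.ker f)
    (hn : (n : N) ∈ D.trace N) : n ∈ D.trace (LinearMap.ker f) := by
  obtain ⟨k, hk, h⟩ := D.exists_fixed_of_mem_trace hn
  have h0 := hM (fun i => f (k i)) (fun i => D.map_mem_fixed f (hk i)) (by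
    have := congrArg f h
    rwa [n.2, map_sum, Finset.sum_congr rfl fun i _ => map_smul f _ _] at this)
  exact ⟨fun i => ⟨k i, h0 i⟩, Subtype.ext (by simpa using h)⟩

/-- A module `M` with `Λ e M = M` on which the multiplication map is injective is determined by
`e M`. -/
noncomputable def equivInd (hM : D.TraceInjective M) (ht : ∀ m : M, m ∈ D.trace M) :
    D.ind (D.fixed M) ≃ₗ[Λ] M :=
  LinearEquiv.ofBijective (D.extend LinearMap.id)
    ⟨(injective_iff_map_eq_zero _).2 fun v hv => funext fun i => Subtype.ext
      (hM (fun i => (v i : M)) (fun i => (v i).2) hv i),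
    fun m => by
      obtain ⟨k, hk, h⟩ := D.exists_fixed_of_mem_trace (ht m)
      exact ⟨fun i => ⟨k i, hk i⟩, h⟩⟩

lemma projDimLE (hM : D.TraceInjective M) (ht : ∀ m : M, m ∈ D.trace M) {a k : ℕ}
    (ha : leftFinDim A ≤ a) (h : ProjDimLE Λ k M) : ProjDimLE Λ a M :=
  .of_equiv (hM.equivInd ht) (D.projDimLE_ind_iff.2
    ((D.projDimLE_ind_iff.1 (h.of_equiv (hM.equivInd ht).symm)).of_leftFinDim_le ha))

end TraceInjective

end Injective

section Red

variable (M : Type u) [AddCommGroup M] [Module Λ M]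

/-- The quotient `M / Λ e M`, which is a `Γ`-module. -/
def red : Type u := M ⧸ D.trace M

noncomputable instance : AddCommGroup (D.red M) := inferInstanceAs (AddCommGroup (M ⧸ D.trace M))

noncomputable instance : Module Λ (D.red M) := inferInstanceAs (Module Λ (M ⧸ D.trace M))

/-- The quotient map. -/
noncomputable def redMk : M →ₗ[Λ] D.red M := (D.trace M).mkQ

lemma redMk_surjective : Function.Surjective (D.redMk M) := (D.trace M).mkQ_surjective

variable {M}

lemma redMk_eq_zero_iff {m : M} : D.redMk M m = 0 ↔ m ∈ D.trace M :=
  Submodule.Quotient.mk_eq_zero _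

lemma smul_red_eq_zero {l : Λ} (hl : D.π l = 0) (q : D.red M) : l • q = 0 := by
  obtain ⟨m, rfl⟩ := D.redMk_surjective M q
  obtain ⟨y, rfl⟩ := D.exists_of_π_eq_zero l hl
  rw [← map_smul, redMk_eq_zero_iff]
  exact ⟨fun i => y i • m, by simp only [← mul_smul, ← Finset.sum_smul]⟩

lemma smul_red_congr {l l' : Λ} (h : D.π l = D.π l') (q : D.red M) : l • q = l' • q := by
  rw [← sub_eq_zero, ← sub_smul]
  exact D.smul_red_eq_zero (by rw [map_sub, h, sub_self]) q

noncomputable instance : SMul Γ (D.red M) := ⟨fun c q => Function.surjInv D.π_surjective c • q⟩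

lemma π_smul (l : Λ) (q : D.red M) : D.π l • q = l • q :=
  D.smul_red_congr (Function.surjInv_eq D.π_surjective _) q

noncomputable instance : Module Γ (D.red M) :=
  Function.Surjective.moduleLeft D.π D.π_surjective D.π_smul

variable {N : Type u} [AddCommGroup N] [Module Λ N]

/-- A `Λ`-linear map between quotients of the form `M / Λ e M` is `Γ`-linear. -/
noncomputable def toΓLinear (f : D.red M →ₗ[Λ] D.red N) : D.red M →ₗ[Γ] D.red N where
  toFun := f
  map_add' := map_add f
  map_smul' c q := by
    obtain ⟨l, rfl⟩ := D.π_surjective c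
    rw [RingHom.id_apply, π_smul, π_smul, map_smul]

/-- The `Γ`-linear map induced on quotients. -/
noncomputable def redMap (f : M →ₗ[Λ] N) : D.red M →ₗ[Γ] D.red N :=
  D.toΓLinear ((D.trace M).mapQ (D.trace N) f fun _ hm => D.map_mem_trace f hm)

lemma redMap_redMk (f : M →ₗ[Λ] N) (m : M) : D.redMap f (D.redMk M m) = D.redMk N (f m) := rfl

lemma redMap_surjective {f : M →ₗ[Λ] N} (hf : Function.Surjective f) :
    Function.Surjective (D.redMap f) := fun q => by
  obtain ⟨n, rfl⟩ := D.redMk_surjective N q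
  obtain ⟨m, rfl⟩ := hf n
  exact ⟨D.redMk M m, rfl⟩

variable (M) in
-- A lift of M → M/ΛeM to a Γ-module kills ΛeM, because e acts as zero there, and so descends to the
-- quotient.
lemma projective_red [Module.Projective Λ M] : Module.Projective Γ (D.red M) := by
  refine Module.Projective.of_lifting_property'' fun f hf => ?_
  let : Module Λ (D.red M →₀ Γ) := Module.compHom _ D.π
  have hsmul (l : Λ) (v : D.red M →₀ Γ) : l • v = D.π l • v := rfl
  let f' : (D.red M →₀ Γ) →ₗ[Λ] D.red M :=
    { toFun := f
      map_add' := map_add f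
      map_smul' := fun l v => by rw [hsmul, map_smul, π_smul]; rfl }
  obtain ⟨g, hg⟩ := Module.projective_lifting_property f' (D.redMk M) hf
  have hker : D.trace M ≤ LinearMap.ker g := by
    intro m hm
    obtain ⟨k, hk, rfl⟩ := D.exists_fixed_of_mem_trace hm
    have h0 (i : ι) : g (k i) = 0 := by
      have h1 := D.mem_fixed.1 (hk i)
      rw [← h1, map_smul, hsmul, D.π_φ_one, zero_smul]
    simp [h0]
  let s : D.red M →ₗ[Λ] (D.red M →₀ Γ) := (D.trace M).liftQ g hker
  have hs (m : M) : s (D.redMk M m) = g m := rfl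
  refine ⟨{ toFun := s, map_add' := map_add s, map_smul' := fun c q => ?_ },
    LinearMap.ext fun q => ?_⟩
  · obtain ⟨l, rfl⟩ := D.π_surjective c
    rw [π_smul, map_smul]
    rfl
  · obtain ⟨m, rfl⟩ := D.redMk_surjective M q
    exact LinearMap.congr_fun hg m

namespace TraceInjective

variable {D}

/-- Reduction commutes with kernels of surjections onto modules with injective multiplication
map. -/
noncomputable def redKer (hN : D.TraceInjective N) (f : M →ₗ[Λ] N) (hf : Function.Surjective f) :
    D.red (LinearMap.ker f) ≃ₗ[Γ] LinearMap.ker (D.redMap f) :=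
  LinearEquiv.ofBijective
    ((D.redMap (LinearMap.ker f).subtype).codRestrict _ fun q => by
      obtain ⟨m, rfl⟩ := D.redMk_surjective _ q
      rw [LinearMap.mem_ker, redMap_redMk, redMap_redMk, Submodule.subtype_apply, m.2, map_zero])
    ⟨(injective_iff_map_eq_zero _).2 fun q hq => by
      obtain ⟨m, rfl⟩ := D.redMk_surjective _ q
      exact D.redMk_eq_zero_iff.2
        (hN.mem_trace_ker f m (D.redMk_eq_zero_iff.1 (congrArg Subtype.val hq))),
    fun ⟨q, hq⟩ => by
      obtain ⟨m, rfl⟩ := D.redMk_surjective _ q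
      obtain ⟨t, ht, hft⟩ := D.exists_mem_trace_of_surjective hf (D.redMk_eq_zero_iff.1 hq)
      refine ⟨D.redMk _ ⟨m - t, by rw [LinearMap.mem_ker, map_sub, hft, sub_self]⟩,
        Subtype.ext ?_⟩
      change D.redMk M (m - t) = D.redMk M m
      rw [map_sub, D.redMk_eq_zero_iff.2 ht, sub_zero]⟩

/-- By `redKer`, reduction commutes with taking syzygies; each syzygy lies in a free module and so
keeps the injectivity needed for the next step. -/
lemma projDimLE_red (hΛ : D.TraceInjective Λ) {d : ℕ} (hM : D.TraceInjective M)
    (h : ProjDimLE Λ d M) : ProjDimLE Γ d (D.red M) := by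
  induction d generalizing M with
  | zero =>
    rw [ProjDimLE.zero_iff] at *
    exact D.projective_red M
  | succ d ih =>
    have hs := Finsupp.linearCombination_id_surjective Λ M
    have := D.projective_red (M →₀ Λ)
    rw [ProjDimLE.succ_iff_ker hs] at h
    rw [ProjDimLE.succ_iff_ker (D.redMap_surjective hs)]
    exact (ih (hΛ.finsupp.of_injective _ (Submodule.injective_subtype _)) h).of_equiv
      (hM.redKer _ hs)

end TraceInjective

end Red

end CornerData

/-! ### The swindle and the bounds from corner and quotient -/

namespace CornerData

variable {ι : Type} [Fintype ι] [DecidableEq ι] {Λ Γ A : Type u} [Ring Λ] [Ring Γ] [Ring A]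
  {D : CornerData ι Λ Γ A} {M : Type u} [AddCommGroup M] [Module Λ M]

/-- Eilenberg's swindle for modules that are projective modulo the trace: such a module becomes,
after adding a free module `L`, isomorphic to `L` modulo the trace. -/
lemma exists_linearMap_of_projective_red [Module.Projective Γ (D.red M)] :
    ∃ (L : Type u) (_ : AddCommGroup L) (_ : Module Λ L) (_ : Module.Projective Λ L)
      (h : L →ₗ[Λ] M × L), (∀ n, ∃ l, n - h l ∈ D.trace (M × L)) ∧
        ∀ l, h l ∈ D.trace (M × L) → l ∈ D.trace L := by
  let F := M →₀ Λ
  let p : F →ₗ[Λ] M := Finsupp.linearCombination Λ id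
  have hp : Function.Surjective p := Finsupp.linearCombination_id_surjective Λ M
  obtain ⟨σ, hσ⟩ := Module.projective_lifting_property (D.redMap p)
    (LinearMap.id : D.red M →ₗ[Γ] D.red M) (D.redMap_surjective hp)
  replace hσ (q : D.red M) : D.redMap p (σ q) = q := LinearMap.congr_fun hσ q
  let τ : F →ₗ[Λ] D.red F :=
    { toFun := fun f => σ (D.redMk M (p f))
      map_add' := fun f g => by rw [map_add, map_add, map_add]
      map_smul' := fun l f => by
        rw [map_smul, map_smul, ← D.π_smul, map_smul, D.π_smul]; rfl }
  -- Modulo the trace, `E` is an idempotent of `F` whose image is the copy of `red M` cut out by the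
  -- section `σ`.
  obtain ⟨E, hE⟩ := Module.projective_lifting_property (D.redMk F) τ (D.redMk_surjective F)
  replace hE (f : F) : D.redMk F (E f) = σ (D.redMk M (p f)) := LinearMap.congr_fun hE f
  have hpE (f : F) : D.redMk M (p (E f)) = D.redMk M (p f) := by
    rw [← D.redMap_redMk, hE, hσ]
  have hEE (f : F) : D.redMk F (E (E f)) = D.redMk F (E f) := by rw [hE, hpE, hE]
  -- The `E`-parts move down one place and the complementary parts stay. The `E`-part of coordinate
  -- 0, which leaves the sequence, is recorded in `M` through `p`.
  let h₂ : (ℕ →₀ F) →ₗ[Λ] (ℕ →₀ F) :=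
    Finsupp.mapRange.linearMap E ∘ₗ Finsupp.lcomapDomain Nat.succ Nat.succ_injective +
      Finsupp.mapRange.linearMap (LinearMap.id - E)
  have h₂_apply (l : ℕ →₀ F) (n : ℕ) : h₂ l n = E (l (n + 1)) + (l n - E (l n)) := rfl
  refine ⟨ℕ →₀ F, inferInstance, inferInstance, inferInstance,
    (p ∘ₗ Finsupp.lapply 0).prod h₂, ?_, ?_⟩
  · rintro ⟨m, g⟩
    obtain ⟨f₀, rfl⟩ := hp m
    -- The inverse modulo the trace: `E`-parts move up one place, and `E f₀` fills coordinate 0.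
    let l : ℕ →₀ F := Finsupp.single 0 (E f₀) + Finsupp.mapRange.linearMap (LinearMap.id - E) g +
      Finsupp.mapRange.linearMap E (Finsupp.lmapDomain F Λ Nat.succ g)
    have hl0 : l 0 = E f₀ + (g 0 - E (g 0)) := by
      simp [l, Finsupp.mapDomain_of_notMem_range]
    have hl (n : ℕ) : l (n + 1) = (g (n + 1) - E (g (n + 1))) + E (g n) := by
      simp [l, ← Nat.succ_eq_add_one, Finsupp.mapDomain_apply Nat.succ_injective]
    refine ⟨l, D.mem_trace_prod ?_ (D.mem_trace_finsupp fun n => ?_)⟩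
    · rw [← D.redMk_eq_zero_iff]
      change D.redMk M (p f₀ - p (l 0)) = 0
      simp [hl0, hpE]
    · rw [← D.redMk_eq_zero_iff]
      change D.redMk F (g n - h₂ l n) = 0
      rw [h₂_apply]
      cases n with
      | zero => simp [hl0, hl, hEE]
      | succ n => simp [hl, hEE]
  · intro l hl
    have h1 : D.redMk M (p (l 0)) = 0 :=
      D.redMk_eq_zero_iff.2 (D.map_mem_trace (LinearMap.fst Λ M (ℕ →₀ F)) hl)
    have h2 (n : ℕ) : D.redMk F (E (l (n + 1)) + (l n - E (l n))) = 0 :=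
      D.redMk_eq_zero_iff.2
        (D.map_mem_trace (Finsupp.lapply n ∘ₗ LinearMap.snd Λ M (ℕ →₀ F)) hl)
    -- Applying `E` to `h2` removes the complementary part and leaves the `E`-part of the next
    -- coordinate.
    have h3 (n : ℕ) : D.redMk F (E (l n)) = 0 := by
      cases n with
      | zero => rw [hE, h1, map_zero]
      | succ n =>
        have := congrArg (D.redMap E) (h2 n)
        rw [D.redMap_redMk] at this
        simpa [hEE] using this
    refine D.mem_trace_finsupp fun n => D.redMk_eq_zero_iff.1 ?_
    have := h2 n
    rwa [map_add, map_sub, h3, h3, zero_add, sub_zero] at this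

namespace TraceInjective

variable (hΛ : D.TraceInjective Λ) {a : ℕ} (ha : leftFinDim A ≤ a)

include hΛ ha in
-- The swindle gives h : L → M ⊕ L bijective modulo the traces. Adding an induced projective that
-- covers the trace of M ⊕ L makes it surjective, with a kernel equal to its own trace and hence
-- induced from `A`.
lemma projDimLE_of_projective_red [Module.Projective Γ (D.red M)] (hM : D.TraceInjective M)
    {k : ℕ} (hk : ProjDimLE Λ k M) : ProjDimLE Λ (a + 1) M := by
  obtain ⟨L, _, _, _, h, h_surj, h_inj⟩ := D.exists_linearMap_of_projective_red (M := M)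
  have hN : D.TraceInjective (M × L) := hM.prod hΛ.of_projective
  let Y := D.fixed (M × L) →₀ A
  have := D.projective_ind (X := Y)
  -- `Y` is free on the underlying set of e(M ⊕ L), so the image of `j` contains the whole trace.
  let j : D.ind Y →ₗ[Λ] M × L := D.extend (Finsupp.linearCombination A id)
  have hj (n : M × L) (hn : n ∈ D.trace (M × L)) : ∃ v, j v = n := by
    obtain ⟨k, hk, hkn⟩ := D.exists_fixed_of_mem_trace hn
    refine ⟨fun i => Finsupp.single ⟨k i, hk i⟩ 1, ?_⟩
    rw [← hkn]
    exact (D.extend_apply _ _).trans (Finset.sum_congr rfl fun i _ =>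
      congrArg (fun z : D.fixed (M × L) => D.x i • (z : M × L)) (a₂ := ⟨k i, hk i⟩)
        ((Finsupp.linearCombination_single A 1 _).trans (one_smul A _)))
  have hs : Function.Surjective (h.coprod j) := fun n => by
    obtain ⟨l, hl⟩ := h_surj n
    obtain ⟨v, hv⟩ := hj _ hl
    exact ⟨(l, v), by simp [hv]⟩
  have hK : ∀ w : LinearMap.ker (h.coprod j), w ∈ D.trace (LinearMap.ker (h.coprod j)) := by
    rintro ⟨⟨l, v⟩, hw⟩
    refine hN.mem_trace_ker _ _ (D.mem_trace_prod (h_inj l ?_) (D.mem_trace_ind v))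
    have : h l = - j v := eq_neg_of_add_eq_zero_left (by simpa using hw)
    rw [this]
    exact neg_mem (D.map_mem_trace j (D.mem_trace_ind v))
  have hKi : D.TraceInjective (LinearMap.ker (h.coprod j)) :=
    (hΛ.of_projective (M := L × D.ind Y)).of_injective _ (Submodule.injective_subtype _)
  -- The value of `k` is irrelevant: finite projective dimension of the kernel suffices to replace
  -- it by `a`.
  have hN' : ProjDimLE Λ (k + 1) (M × L) := (hk.mono k.le_succ).prod_projective
  rw [ProjDimLE.succ_iff_ker hs] at hN'
  have := (ProjDimLE.succ_iff_ker hs).2 (hKi.projDimLE hK ha hN')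
  exact this.of_retract (LinearMap.inl Λ M L) (LinearMap.fst Λ M L) (LinearMap.fst_comp_inl ..)

include hΛ ha in
-- Each syzygy lowers the Γ-dimension of the reduction by one, until the projective case applies.
lemma projDimLE_of_red {g k : ℕ} (hM : D.TraceInjective M) (hg : ProjDimLE Γ g (D.red M))
    (hk : ProjDimLE Λ k M) : ProjDimLE Λ (g + a + 1) M := by
  induction g generalizing M k with
  | zero =>
    rw [ProjDimLE.zero_iff] at hg
    rw [zero_add]
    exact hΛ.projDimLE_of_projective_red ha hM hk
  | succ g ih =>
    have hs := Finsupp.linearCombination_id_surjective Λ M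
    have := D.projective_red (M →₀ Λ)
    rw [ProjDimLE.succ_iff_ker (D.redMap_surjective hs)] at hg
    replace hk := hk.mono k.le_succ
    rw [ProjDimLE.succ_iff_ker hs] at hk
    rw [show g + 1 + a + 1 = (g + a + 1) + 1 by ring, ProjDimLE.succ_iff_ker hs]
    exact ih (hΛ.finsupp.of_injective _ (Submodule.injective_subtype _))
      (hg.of_equiv (hM.redKer _ hs).symm) hk

end TraceInjective

/-- If the multiplication map is injective for all modules, then the finitistic dimension of `Λ`
is at most one more than the sum of those of the quotient and the corner ring. -/
theorem leftFinDim_le_of_forall (D : CornerData ι Λ Γ A)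
    (h : ∀ (M : Type u) [AddCommGroup M] [Module Λ M], D.TraceInjective M) :
    leftFinDim Λ ≤ leftFinDim Γ + leftFinDim A + 1 := by
  rcases eq_or_ne (leftFinDim Γ) ⊤ with hΓ | hΓ
  · simp [hΓ]
  rcases eq_or_ne (leftFinDim A) ⊤ with hA | hA
  · simp [hA]
  obtain ⟨g, hg⟩ := ENat.ne_top_iff_exists.1 hΓ
  obtain ⟨a, ha⟩ := ENat.ne_top_iff_exists.1 hA
  rw [← hg, ← ha]
  refine leftFinDim_le_iff (d := g + a + 1).2 fun M _ _ k hk => ?_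
  exact (h Λ).projDimLE_of_red ha.ge (h M)
    (((h Λ).projDimLE_red (h M) hk).of_leftFinDim_le hg.ge) hk

/-- If the multiplication map is injective for the regular module, then the finitistic dimension
of `Λ` is at most two more than the sum of those of the quotient and the corner ring. -/
theorem leftFinDim_le (D : CornerData ι Λ Γ A) (hΛ : D.TraceInjective Λ) :
    leftFinDim Λ ≤ leftFinDim Γ + leftFinDim A + 2 := by
  rcases eq_or_ne (leftFinDim Γ) ⊤ with hΓ | hΓ
  · simp [hΓ]
  rcases eq_or_ne (leftFinDim A) ⊤ with hA | hA
  · simp [hA]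
  obtain ⟨g, hg⟩ := ENat.ne_top_iff_exists.1 hΓ
  obtain ⟨a, ha⟩ := ENat.ne_top_iff_exists.1 hA
  rw [← hg, ← ha]
  refine leftFinDim_le_iff (d := g + a + 2).2 fun M _ _ k hk => ?_
  have hs := Finsupp.linearCombination_id_surjective Λ M
  -- Pass to the first syzygy, which lies in a free module and so has injective multiplication map;
  -- this costs the second unit.
  replace hk := hk.mono k.le_succ
  rw [ProjDimLE.succ_iff_ker hs] at hk
  have hK : D.TraceInjective (LinearMap.ker (Finsupp.linearCombination Λ (id : M → M))) :=
    hΛ.finsupp.of_injective _ (Submodule.injective_subtype _)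
  exact (ProjDimLE.succ_iff_ker hs).2 (hΛ.projDimLE_of_red ha.ge hK
    ((hΛ.projDimLE_red hK hk).of_leftFinDim_le hg.ge) hk)

/-- If the idempotent generates the unit ideal and the multiplication map is injective for all
modules, then the finitistic dimension of `Λ` is at most that of the corner ring. -/
theorem leftFinDim_le_corner (D : CornerData ι Λ Γ A)
    (h : ∀ (M : Type u) [AddCommGroup M] [Module Λ M], D.TraceInjective M) (h1 : D.π 1 = 0) :
    leftFinDim Λ ≤ leftFinDim A := by
  rcases eq_or_ne (leftFinDim A) ⊤ with hA | hA
  · simp [hA]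
  obtain ⟨a, ha⟩ := ENat.ne_top_iff_exists.1 hA
  rw [← ha]
  refine leftFinDim_le_iff.2 fun M _ _ k hk => ?_
  refine (h M).projDimLE (fun m => ?_) ha.ge hk
  rw [← D.redMk_eq_zero_iff, ← one_smul Λ (D.redMk M m), D.smul_red_eq_zero h1]

/-- The multiplication map is injective for all modules if the basis consists of the
idempotent. -/
lemma traceInjective_of_unique [Unique ι] (D : CornerData ι Λ Γ A) : D.TraceInjective M := by
  intro k hk h i
  rw [Fintype.sum_unique, Subsingleton.elim default D.i₀, D.x_i₀, D.mem_fixed.1 (hk D.i₀)] at h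
  rwa [Subsingleton.elim i D.i₀]

end CornerData

/-! ### The matrix ring and its block quotients -/

namespace MatrixRingData

variable {A : Type u} [Ring A] {n : ℕ} (D : MatrixRingData A n)

lemma apply_mem_I {M : Matrix (Fin n) (Fin n) A} (hM : M ∈ D.matrixRing) {i j : Fin n}
    (h : i < j) : M i j ∈ D.I (j + 1) := by
  have := hM i j
  have h' : (i : ℕ) < j := h
  rwa [entry, if_neg (by omega), if_pos (by omega)] at this

lemma apply_mem_B {M : Matrix (Fin n) (Fin n) A} (hM : M ∈ D.matrixRing) {j : Fin n}
    (hj : 1 ≤ (j : ℕ)) : M j j ∈ D.B (j + 1) := by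
  have := hM j j
  rwa [entry, if_neg (by omega), if_neg (lt_irrefl _), if_pos rfl] at this

lemma I_le_I {i j : Fin n} (hi : 1 ≤ (i : ℕ)) (h : i ≤ j) : D.I (j + 1) ≤ D.I (i + 1) :=
  D.I_anti _ _ (by omega) (by simpa using h) (by omega)

lemma mem_entry_of_mem_I {i j : Fin n} {a : A} (h : a ∈ D.I (j + 1)) :
    a ∈ D.entry (i + 1) (j + 1) := by
  unfold entry
  split_ifs with h1 h2 h3
  · trivial
  · exact h
  · rw [h3]; exact D.I_sub_B _ (by omega) (by omega) _ h
  · exact D.I_le_J _ _ (by omega) (by omega) (by omega) h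

lemma single_mem {i j : Fin n} {a : A} (ha : a ∈ D.entry (i + 1) (j + 1)) :
    Matrix.single i j a ∈ D.matrixRing := by
  intro i' j'
  rw [Matrix.single_apply]
  split_ifs with h
  · rw [← h.1, ← h.2]; exact ha
  · exact zero_mem _

/-- The two-sided ideal of all matrices in `Λ` whose entries in the upper left `k × k` block,
except for those in the first column, lie in the ideals `I j`. -/
def blockIdeal (k : ℕ) : Ideal D.matrixRing where
  carrier := {M | ∀ i j : Fin n, (i : ℕ) < k → (j : ℕ) < k → 1 ≤ (j : ℕ) →
    (M : Matrix (Fin n) (Fin n) A) i j ∈ D.I (j + 1)}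
  zero_mem' := fun _ _ _ _ _ => zero_mem _
  add_mem' := fun hM hN i j hi hj h1 => add_mem (hM i j hi hj h1) (hN i j hi hj h1)
  smul_mem' := fun N M hM i j hi hj h1 => by
    change ((N : Matrix (Fin n) (Fin n) A) * (M : Matrix (Fin n) (Fin n) A)) i j ∈ _
    rw [Matrix.mul_apply]
    refine sum_mem fun l _ => ?_
    -- For `l` outside the block, the entry of `N` at `(i, l)` is above the diagonal, so it lies in
    -- `I (l + 1)`, which is contained in `I (j + 1)`.
    by_cases hl : (l : ℕ) < k
    · exact (D.I (j + 1)).mul_mem_left _ (hM l j hl hj h1)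
    · exact (D.I (j + 1)).mul_mem_right _ (D.I_le_I h1 (Fin.le_def.2 (by omega))
        (D.apply_mem_I N.2 (Fin.lt_def.2 (by omega))))

lemma mem_blockIdeal {k : ℕ} {M : D.matrixRing} : M ∈ D.blockIdeal k ↔
    ∀ i j : Fin n, (i : ℕ) < k → (j : ℕ) < k → 1 ≤ (j : ℕ) →
      (M : Matrix (Fin n) (Fin n) A) i j ∈ D.I (j + 1) := Iff.rfl

instance (k : ℕ) : (D.blockIdeal k).IsTwoSided where
  mul_mem_of_left {M} N hM i j hi hj h1 := by
    change ((M : Matrix (Fin n) (Fin n) A) * (N : Matrix (Fin n) (Fin n) A)) i j ∈ _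
    rw [Matrix.mul_apply]
    refine sum_mem fun l _ => ?_
    rcases lt_or_ge l j with hlj | hlj
    · exact (D.I (j + 1)).mul_mem_left _ (D.apply_mem_I N.2 hlj)
    · refine (D.I (j + 1)).mul_mem_right _ (D.I_le_I h1 hlj ?_)
      rw [Fin.le_def] at hlj
      by_cases hl : (l : ℕ) < k
      · exact hM i l hi hl (by omega)
      · exact D.apply_mem_I M.2 (Fin.lt_def.2 (by omega))

lemma blockIdeal_anti {k l : ℕ} (h : k ≤ l) : D.blockIdeal l ≤ D.blockIdeal k :=
  fun _ hM i j hi hj => hM i j (by omega) (by omega)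

lemma blockIdeal_one : D.blockIdeal 1 = ⊤ :=
  eq_top_iff.2 fun _ _ i j hi hj h1 => by omega

/-- The quotient of `Λ` by `blockIdeal k`. -/
abbrev blockQuotient (k : ℕ) : Type u := D.matrixRing ⧸ D.blockIdeal k

/-- The quotient map to the block quotient. -/
def blockMk (k : ℕ) : D.matrixRing →+* D.blockQuotient k := Ideal.Quotient.mk _

lemma blockMk_surjective (k : ℕ) : Function.Surjective (D.blockMk k) :=
  Ideal.Quotient.mk_surjective

lemma blockMk_add (k : ℕ) (M N : D.matrixRing) :
    D.blockMk k (M + N) = D.blockMk k M + D.blockMk k N := rfl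

lemma blockMk_mul (k : ℕ) (M N : D.matrixRing) :
    D.blockMk k (M * N) = D.blockMk k M * D.blockMk k N := rfl

lemma blockMk_eq_iff {k : ℕ} {M N : D.matrixRing} :
    D.blockMk k M = D.blockMk k N ↔ M - N ∈ D.blockIdeal k :=
  Ideal.Quotient.mk_eq_mk_iff_sub_mem M N

lemma blockMk_eq_zero_iff {k : ℕ} {M : D.matrixRing} :
    D.blockMk k M = 0 ↔ M ∈ D.blockIdeal k := Ideal.Quotient.eq_zero_iff_mem

lemma blockMk_one_eq_zero : D.blockMk 1 1 = 0 := by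
  rw [blockMk_eq_zero_iff, blockIdeal_one]
  trivial

section First

variable (h0 : 0 < n)

/-- The idempotent in the upper left corner of `Λ` has corner ring `A`, and `Λ` acts on the first
column by matrix multiplication. -/
def firstCorner : CornerData (Fin n) D.matrixRing (D.blockQuotient n) A where
  π := D.blockMk n
  ρ := D.matrixRing.subtype
  φ :=
    { toFun := fun a => ⟨Matrix.single ⟨0, h0⟩ ⟨0, h0⟩ a, D.single_mem (by simp [entry])⟩
      map_zero' := Subtype.ext (Matrix.single_zero _ _)
      map_add' := fun a b => Subtype.ext (Matrix.single_add _ _ a b) }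
  i₀ := ⟨0, h0⟩
  x i := ⟨Matrix.single i ⟨0, h0⟩ 1, D.single_mem (by simp [entry])⟩
  π_surjective := D.blockMk_surjective n
  φ_mul a b := Subtype.ext (by simp)
  x_i₀ := rfl
  x_mul i := Subtype.ext (by simp)
  ρ_φ a := rfl
  ρ_x i := rfl
  mul_x l i := Subtype.ext (by
    ext i' j'
    by_cases h : j' = ⟨0, h0⟩
    · subst h
      simp [Matrix.sum_apply, Matrix.single_apply]
    · simp [Matrix.sum_apply, h, Ne.symm h])
  π_φ_one := by
    rw [blockMk_eq_zero_iff]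
    intro i j hi hj h1
    have : (⟨0, h0⟩ : Fin n) ≠ j := fun h => by rw [← h] at h1; simp at h1
    simp [this]
  exists_of_π_eq_zero l hl := by
    rw [blockMk_eq_zero_iff, mem_blockIdeal] at hl
    -- `y i` is row `i` of `l` moved to the first row. It stays in Λ because `I j` is allowed
    -- everywhere in column `j`.
    refine ⟨fun i => ⟨Matrix.of fun i' j' => if i' = ⟨0, h0⟩ then (l : Matrix _ _ A) i j' else 0,
      fun i' j' => ?_⟩, Subtype.ext ?_⟩
    · by_cases h : i' = ⟨0, h0⟩
      · rw [Matrix.of_apply, if_pos h]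
        by_cases hj : 1 ≤ (j' : ℕ)
        · exact D.mem_entry_of_mem_I (hl i j' i.2 j'.2 hj)
        · simp [entry, show (j' : ℕ) = 0 by omega]
      · rw [Matrix.of_apply, if_neg h]
        exact zero_mem _
    · ext i' j'
      simp [Matrix.sum_apply, Matrix.mul_apply, Matrix.single_apply]

/-- The sum stores the first row of each `k i` as its own row `i`, so nothing can cancel; the other
rows of `k i` vanish because e fixes `k i`. -/
lemma firstCorner_traceInjective : (D.firstCorner h0).TraceInjective D.matrixRing := by
  intro k hk h i
  have hrow (j' : Fin n) : (k i : Matrix (Fin n) (Fin n) A) ⟨0, h0⟩ j' = 0 := by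
    have := congrFun (congrFun (congrArg Subtype.val h) i) j'
    simpa [firstCorner, Matrix.sum_apply, Matrix.mul_apply, Matrix.single_apply, ite_and] using this
  rw [← (D.firstCorner h0).mem_fixed.1 (hk i)]
  refine Subtype.ext ?_
  ext i' j'
  simp [firstCorner, Matrix.mul_apply, Matrix.single_apply, ite_and, hrow]

end First

section Diagonal

variable {m : ℕ} (h1 : 1 ≤ m) (hm : m < n)

/-- The diagonal entry of a matrix in `Λ`, as a ring homomorphism to the quotient ring. -/
def diagHom : D.matrixRing →+* D.diagQuotient (m + 1) where
  toFun M := Ideal.Quotient.mk _ ⟨_, D.apply_mem_B M.2 (j := ⟨m, hm⟩) h1⟩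
  map_zero' := map_zero _
  map_add' M N := rfl
  map_one' := by
    rw [← map_one (Ideal.Quotient.mk _)]
    congr 1
    exact Subtype.ext (Matrix.one_apply_eq _)
  map_mul' M N := by
    rw [← map_mul, Ideal.Quotient.mk_eq_mk_iff_sub_mem]
    change ((M : Matrix (Fin n) (Fin n) A) * (N : Matrix (Fin n) (Fin n) A)) ⟨m, hm⟩ ⟨m, hm⟩ -
      (M : Matrix (Fin n) (Fin n) A) ⟨m, hm⟩ ⟨m, hm⟩ *
      (N : Matrix (Fin n) (Fin n) A) ⟨m, hm⟩ ⟨m, hm⟩ ∈ D.I (m + 1)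
    rw [Matrix.mul_apply, Finset.sum_eq_add_sum_sdiff_singleton_of_mem (Finset.mem_univ ⟨m, hm⟩),
      add_sub_cancel_left]
    refine sum_mem fun l hl => ?_
    -- In each off-diagonal product one factor lies above the diagonal: that of `N` if `l < m`, that
    -- of `M` if `l > m`.
    rcases lt_or_gt_of_ne (show l ≠ ⟨m, hm⟩ by simpa using hl) with h | h
    · exact (D.I (m + 1)).mul_mem_left _ (D.apply_mem_I N.2 h)
    · exact (D.I (m + 1)).mul_mem_right _ (D.I_le_I (i := ⟨m, hm⟩) h1 h.le (D.apply_mem_I M.2 h))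

/-- The diagonal matrix unit with a coefficient in the subring. -/
def diagUnit (b : D.B (m + 1)) : D.matrixRing :=
  ⟨Matrix.single ⟨m, hm⟩ ⟨m, hm⟩ b, D.single_mem (by
    unfold entry
    split_ifs with h2 h3 h4
    · trivial
    · exact absurd h3 (lt_irrefl _)
    · exact b.2
    · exact absurd rfl h4)⟩

/-- The diagonal matrix unit with a coefficient in the quotient ring, as an element of the
block quotient. -/
def diagIncl : D.diagQuotient (m + 1) →+ D.blockQuotient (m + 1) :=
  QuotientAddGroup.lift _
    ({ toFun := fun b => D.blockMk _ (D.diagUnit hm b)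
       map_zero' := D.blockMk_eq_zero_iff.2 fun i j _ _ _ => by
        simp [diagUnit]
       map_add' := fun b c => (congrArg (D.blockMk (m + 1))
        (Subtype.ext (Matrix.single_add _ _ _ _))).trans (D.blockMk_add _ _ _) } :
      D.B (m + 1) →+ D.blockQuotient (m + 1))
    fun b hb => D.blockMk_eq_zero_iff.2 fun i j _ _ _ => by
      simp only [diagUnit, Matrix.single_apply]
      split_ifs with h
      · rw [← h.2]; exact hb
      · exact zero_mem _

lemma diagIncl_mk (b : D.B (m + 1)) :
    D.diagIncl hm (Ideal.Quotient.mk _ b) = D.blockMk _ (D.diagUnit hm b) := rfl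

lemma diagIncl_one : D.diagIncl hm 1 = D.blockMk _ (D.diagUnit hm 1) := rfl

lemma diagIncl_mul (a b : D.diagQuotient (m + 1)) :
    D.diagIncl hm (a * b) = D.diagIncl hm a * D.diagIncl hm b := by
  obtain ⟨a, rfl⟩ := Ideal.Quotient.mk_surjective a
  obtain ⟨b, rfl⟩ := Ideal.Quotient.mk_surjective b
  rw [← map_mul, diagIncl_mk, diagIncl_mk, diagIncl_mk, ← blockMk_mul]
  exact congrArg _ (Subtype.ext (by simp [diagUnit]))

/-- The last diagonal entry, as a ring homomorphism on the block quotient. -/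
def blockDiagHom : D.blockQuotient (m + 1) →+* D.diagQuotient (m + 1) :=
  Ideal.Quotient.lift _ (D.diagHom h1 hm) fun M hM =>
    Ideal.Quotient.eq_zero_iff_mem.2 (hM ⟨m, hm⟩ ⟨m, hm⟩ (by simp) (by simp) h1)

lemma blockDiagHom_blockMk (M : D.matrixRing) : D.blockDiagHom h1 hm (D.blockMk _ M) =
    Ideal.Quotient.mk _ ⟨_, D.apply_mem_B M.2 (j := ⟨m, hm⟩) h1⟩ := rfl

lemma blockDiagHom_diagIncl (a : D.diagQuotient (m + 1)) :
    D.blockDiagHom h1 hm (D.diagIncl hm a) = a := by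
  obtain ⟨b, rfl⟩ := Ideal.Quotient.mk_surjective a
  rw [diagIncl_mk, blockDiagHom_blockMk]
  exact congrArg _ (Subtype.ext (Matrix.single_apply_same _ _ _))

/-- The last diagonal idempotent of the block quotient has corner ring `A_i / I_i`. -/
def diagCorner : CornerData Unit (D.blockQuotient (m + 1)) (D.blockQuotient m)
    (D.diagQuotient (m + 1)) where
  π := Ideal.Quotient.factor (D.blockIdeal_anti m.le_succ)
  ρ := (Matrix.scalar Unit).comp (D.blockDiagHom h1 hm)
  φ := D.diagIncl hm
  i₀ := ()
  x _ := D.diagIncl hm 1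
  π_surjective := Ideal.Quotient.factor_surjective _
  φ_mul := D.diagIncl_mul hm
  x_i₀ := rfl
  x_mul _ := by rw [← diagIncl_mul, one_mul]
  ρ_φ a := by
    ext
    simp [blockDiagHom_diagIncl]
  ρ_x _ := by
    ext
    simp [blockDiagHom_diagIncl]
  mul_x l _ := by
    obtain ⟨M, rfl⟩ := D.blockMk_surjective _ l
    rw [Fintype.sum_unique, ← diagIncl_mul, one_mul, diagIncl_one, ← blockMk_mul]
    change _ = D.blockMk _ (D.diagUnit hm
      ⟨(M : Matrix (Fin n) (Fin n) A) ⟨m, hm⟩ ⟨m, hm⟩, D.apply_mem_B M.2 (j := ⟨m, hm⟩) h1⟩)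
    -- Within the block, column `m` has only entries of `I (m + 1)` above the diagonal and nothing
    -- below it, so only the diagonal entry survives.
    rw [blockMk_eq_iff]
    intro i j hi hj hj1
    change ((M : Matrix (Fin n) (Fin n) A) * Matrix.single (⟨m, hm⟩ : Fin n) (⟨m, hm⟩ : Fin n) 1 -
      Matrix.single (⟨m, hm⟩ : Fin n) (⟨m, hm⟩ : Fin n)
        ((M : Matrix (Fin n) (Fin n) A) ⟨m, hm⟩ ⟨m, hm⟩) : Matrix (Fin n) (Fin n) A) i j ∈ _
    by_cases h : j = ⟨m, hm⟩
    · subst h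
      by_cases h' : i = ⟨m, hm⟩
      · subst h'; simp
      · have hlt : i < ⟨m, hm⟩ := lt_of_le_of_ne (Fin.le_def.2 (by simp; omega)) h'
        simpa [Ne.symm h'] using D.apply_mem_I M.2 hlt
    · simp [Ne.symm h, h]
  π_φ_one := by
    change D.blockMk m (D.diagUnit hm 1) = 0
    rw [blockMk_eq_zero_iff]
    intro i j hi hj _
    have : (⟨m, hm⟩ : Fin n) ≠ i := fun h => by rw [← h] at hi; simp at hi
    simp [diagUnit, this]
  exists_of_π_eq_zero l hl := by
    obtain ⟨M, rfl⟩ := D.blockMk_surjective _ l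
    change D.blockMk m M = 0 at hl
    rw [blockMk_eq_zero_iff, mem_blockIdeal] at hl
    -- An element vanishing in the smaller quotient has only its last row left, so the idempotent
    -- fixes it from the left.
    refine ⟨fun _ => D.blockMk _ M, ?_⟩
    rw [Fintype.sum_unique, diagIncl_one, ← blockMk_mul, blockMk_eq_iff]
    intro i j hi hj hj1
    change (Matrix.single (⟨m, hm⟩ : Fin n) (⟨m, hm⟩ : Fin n) 1 * (M : Matrix (Fin n) (Fin n) A) -
      (M : Matrix (Fin n) (Fin n) A) : Matrix (Fin n) (Fin n) A) i j ∈ _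
    by_cases h : i = ⟨m, hm⟩
    · subst h; simp
    · have hi' : (i : ℕ) < m := by
        have : (i : ℕ) ≠ m := fun h' => h (Fin.ext h')
        omega
      have : (M : Matrix (Fin n) (Fin n) A) i j ∈ D.I (j + 1) := by
        by_cases hj' : (j : ℕ) < m
        · exact hl i j hi' hj' hj1
        · exact D.apply_mem_I M.2 (Fin.lt_def.2 (by omega))
      simpa [h] using this

end Diagonal

/-- The finitistic dimension of the lower triangular ring `Λ / Λ e Λ`. -/
lemma leftFinDim_blockQuotient_le (m : ℕ) (hm : m + 2 ≤ n) :
    leftFinDim (D.blockQuotient (m + 2)) ≤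
      ∑ i ∈ Finset.Icc 2 (m + 2), leftFinDim (D.diagQuotient i) + m := by
  induction m with
  | zero =>
    -- `blockQuotient 1` is the zero ring, so the idempotent generates the unit ideal and no extra
    -- unit is lost.
    have := (D.diagCorner (m := 1) le_rfl hm).leftFinDim_le_corner
      (fun _ _ _ => CornerData.traceInjective_of_unique _) D.blockMk_one_eq_zero
    simpa using this
  | succ m ih =>
    have := (D.diagCorner (m := m + 2) (by omega) hm).leftFinDim_le_of_forall
      (fun _ _ _ => CornerData.traceInjective_of_unique _)
    rw [show m + 1 + 2 = m + 2 + 1 by ring, Finset.sum_Icc_succ_top (by omega)]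
    refine this.trans ((add_le_add_left (add_le_add_left (ih (by omega)) _) _).trans_eq ?_)
    push_cast
    ring

end MatrixRingData

theorem corollary4p6 {A : Type u} [Ring A] {n : ℕ} (hn : 1 ≤ n) (D : MatrixRingData A n) :
    leftFinDim A ≤ leftFinDim D.matrixRing + 1 ∧
    leftFinDim D.matrixRing ≤
      (n : ℕ∞) + ∑ i ∈ Finset.Icc 2 n, leftFinDim (D.diagQuotient i) + leftFinDim A := by
  refine ⟨(D.firstCorner hn).leftFinDim_corner_le.trans le_self_add, ?_⟩
  -- For n = 1 the quotient by the ideal of the idempotent is zero, and the corner alone gives the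
  -- bound.
  rcases hn.eq_or_lt with rfl | hn2
  · refine ((D.firstCorner hn).leftFinDim_le_corner
      (fun _ _ _ => CornerData.traceInjective_of_unique _) D.blockMk_one_eq_zero).trans le_add_self
  · obtain ⟨m, rfl⟩ := Nat.exists_eq_add_of_le' hn2
    -- With n = m + 2, the first corner costs 2 and the triangular quotient costs m.
    refine ((D.firstCorner hn).leftFinDim_le (D.firstCorner_traceInjective hn)).trans ?_
    refine (add_le_add_left (add_le_add_left (D.leftFinDim_blockQuotient_le m le_rfl) _) _).trans_eq
      ?_
    push_cast
    ring
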